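/- Let $V$ be a finite-dimensional real vector space and let $X=[a_1,\dots,a_m]$ be a list of nonzero vectors of $V$ that spans $V$ and generates a pointed cone, i.e. the cone $C(X)=\{\sum_{i=1}^m t_ia_i : t_i\ge 0\}$ contains no line. Let $T_X$ be the multivariate spline of $X$, i.e. the distribution on $V$ defined on test functions $f$ by $$\langle T_X\,|\,f\rangle=\int_0^\infty\cdots\int_0^\infty f\Big(\sum_{i=1}^m t_ia_i\Big)\,dt_1\cdots dt_m .$$ A cocircuit of $X$ is a sublist $Y$ of $X$ such that $X\setminus Y$ does not span $V$ and which is minimal with this property. Let $D(X)$ be the space of all distributions $f$ on $V$ such that $\partial_Yf=0$ for every cocircuit $Y$ of $X$, where $\partial_Y=\prod_{a\in Y}\partial_a$ and $\partial_a$ is the directional derivative along $a$. A big cell is a connected component of the complement in $V$ of the union of the cones $C(Y)$ over all sublists $Y$ of $X$ that do not span $V$ (with $C(\emptyset)=\{0\}$). Fix a Lebesgue measure $dx$ on $V$. Then for every big cell $\mathfrak c$ there is a polynomial density $P(x)\,dx$ on $V$, with $P$ a polynomial function on $V$, that belongs to $D(X)$ and agrees with $T_X$ on $\mathfrak c$,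 i.e. $\langle T_X\,|\,f\rangle=\int_V f(x)P(x)\,dx$ for every test function $f$ with support in $\mathfrak c$. -/

import Mathlib

open MeasureTheory TopologicalSpace
open scoped Distributions LineDeriv

namespace BigCell

section Cones

variable {V : Type*} [AddCommGroup V] [Module ℝ V] {m : ℕ}

/-- The cone `C(Y)` generated by the sublist `Y` of the list `X = [X 0, …, X (m - 1)]` consisting of
the elements with index in `I`; the empty sublist generates the cone `{0}`. -/
def cone (X : Fin m → V) (I : Finset (Fin m)) : PointedCone ℝ V :=
  PointedCone.hull ℝ (X '' I)

/-- The sublist of `X` consisting of the elements with index in `I` spans `V`. -/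
def Spans (X : Fin m → V) (I : Finset (Fin m)) : Prop :=
  Submodule.span ℝ (X '' (I : Set (Fin m))) = ⊤

/-- The cone `C(X)` is pointed in the sense that it contains no line
(this is called `Salient` in Mathlib). -/
def GeneratesPointedCone (X : Fin m → V) : Prop :=
  (cone X Finset.univ : ConvexCone ℝ V).Salient

/-- The singular vectors: the union of the cones `C(Y)` over all sublists `Y` of `X`
that do not span `V`. -/
def singularVectors (X : Fin m → V) : Set V :=
  ⋃ I ∈ {I : Finset (Fin m) | ¬ Spans X I}, (cone X I : Set V)

/-- The sublist with index set `I` is a cocircuit: its complement in `X` does not span `V`, and it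
is minimal with this property. -/
def IsCocircuit (X : Fin m → V) (I : Finset (Fin m)) : Prop :=
  Minimal (fun J : Finset (Fin m) => ¬ Spans X Jᶜ) I

/-- A polynomial function on `V`: a polynomial expression in linear forms on `V`. -/
def IsPolynomialFunction (p : V → ℝ) : Prop :=
  ∃ P : MvPolynomial (Module.Dual ℝ V) ℝ, ∀ x, p x = MvPolynomial.eval (fun l => l x) P

/-- A big cell is a connected component of the complement of the set of singular vectors. -/
def IsBigCell [TopologicalSpace V] (X : Fin m → V) (c : Set V) : Prop :=
  ∃ x ∈ (singularVectors X)ᶜ, c = connectedComponentIn (singularVectors X)ᶜ x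

/-- A nonnegative relation between nonzero vectors generating a pointed cone is trivial. -/
theorem eq_zero_of_sum_smul_eq_zero {X : Fin m → V} (hX : ∀ i, X i ≠ 0)
    (hC : GeneratesPointedCone X) {t : Fin m → ℝ} (ht : 0 ≤ t) (h : ∑ i, t i • X i = 0) :
    t = 0 := by
  have mem : ∀ i, t i • X i ∈ cone X Finset.univ := fun i =>
    PointedCone.smul_mem _ (ht i) (PointedCone.subset_hull ⟨i, by simp, rfl⟩)
  funext i
  by_contra hne
  refine hC (t i • X i) (mem i) (smul_ne_zero hne (hX i)) ?_
  have : -(t i • X i) = ∑ j ∈ Finset.univ.erase i, t j • X j := by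
    rw [← Finset.add_sum_erase _ _ (Finset.mem_univ i)] at h
    exact neg_eq_of_add_eq_zero_right h
  rw [this]
  exact Submodule.sum_mem (cone X Finset.univ) fun j _ => mem j

end Cones

section Distributions

variable {V : Type*} [NormedAddCommGroup V] [NormedSpace ℝ V] {m : ℕ}

/-- The space of (real) distributions on `V`. -/
abbrev Distr (V : Type*) [NormedAddCommGroup V] [NormedSpace ℝ V] : Type _ :=
  𝓓'((⊤ : Opens V), ℝ)

/-- `∂_Y f`, the composition of the directional derivatives `∂_a` over the elements `a` of the
sublist `Y` of `X` with index set `I`, applied to the distribution `f`. -/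
noncomputable def partialSublist (X : Fin m → V) (I : Finset (Fin m)) (f : Distr V) : Distr V :=
  ∂^{fun i : Fin I.card => X (I.orderEmbOfFin rfl i)} f

/-- The space `D(X)` of all distributions annihilated by `∂_Y` for every cocircuit `Y` of `X`. -/
noncomputable def dahmenMicchelli (X : Fin m → V) : Submodule ℝ (Distr V) where
  carrier := {f | ∀ I, IsCocircuit X I → partialSublist X I f = 0}
  add_mem' hf hg I hI := by
    have h1 := hf I hI
    have h2 := hg I hI
    simp only [partialSublist] at *
    rw [LineDeriv.iteratedLineDerivOp_add, h1, h2, add_zero]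
  zero_mem' I _ := by simp [partialSublist]
  smul_mem' c f hf I hI := by
    have h1 := hf I hI
    simp only [partialSublist] at *
    rw [LineDeriv.iteratedLineDerivOp_smul, h1, smul_zero]

/-- `f` is the polynomial density `p(x) dx` on `V`, for some polynomial function `p`. -/
def IsPolynomialDensity [MeasurableSpace V] (dx : Measure V) (f : Distr V) : Prop :=
  ∃ p : V → ℝ, IsPolynomialFunction p ∧ ∀ φ : 𝓓((⊤ : Opens V), ℝ), f φ = ∫ x, p x * φ x ∂dx

/-- The distributions `f` and `g` agree on the (open) set `s`: they have the same value at every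
test function with support in `s`. -/
def AgreeOn (f g : Distr V) (s : Set V) : Prop :=
  ∀ φ : 𝓓((⊤ : Opens V), ℝ), tsupport φ ⊆ s → f φ = g φ

theorem continuous_sum_smul (X : Fin m → V) :
    Continuous fun t : Fin m → ℝ => ∑ i, t i • X i := by fun_prop

theorem exists_norm_le {X : Fin m → V} (hX : ∀ i, X i ≠ 0) (hC : GeneratesPointedCone X) :
    ∃ C : ℝ, ∀ t : Fin m → ℝ, 0 ≤ t → ‖t‖ ≤ C * ‖∑ i, t i • X i‖ := by
  have hcont := continuous_sum_smul X
  have hK : IsCompact (Metric.sphere (0 : Fin m → ℝ) 1 ∩ Set.Ici 0) :=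
    (isCompact_sphere _ _).inter_right isClosed_Ici
  rcases (Metric.sphere (0 : Fin m → ℝ) 1 ∩ Set.Ici 0).eq_empty_or_nonempty with he | hne
  · refine ⟨0, fun t ht => ?_⟩
    by_cases h0 : t = 0
    · simp [h0]
    · exfalso
      have hpos : 0 < ‖t‖ := norm_pos_iff.2 h0
      have : ‖t‖⁻¹ • t ∈ Metric.sphere (0 : Fin m → ℝ) 1 ∩ Set.Ici 0 := by
        refine ⟨?_, ?_⟩
        · simp [norm_smul, hpos.ne']
        · exact smul_nonneg (inv_nonneg.2 hpos.le) ht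
      rw [he] at this
      exact this
  · obtain ⟨s, hs, hmin⟩ := hK.exists_isMinOn hne hcont.norm.continuousOn
    have hspos : 0 < ‖∑ i, s i • X i‖ := by
      refine norm_pos_iff.2 fun h => ?_
      have := eq_zero_of_sum_smul_eq_zero hX hC hs.2 h
      have h1 := hs.1
      simp [this] at h1
    refine ⟨‖∑ i, s i • X i‖⁻¹, fun t ht => ?_⟩
    by_cases h0 : t = 0
    · simp [h0]
    have hpos : 0 < ‖t‖ := norm_pos_iff.2 h0
    have hmem : ‖t‖⁻¹ • t ∈ Metric.sphere (0 : Fin m → ℝ) 1 ∩ Set.Ici 0 :=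
      ⟨by simp [norm_smul, hpos.ne'], smul_nonneg (inv_nonneg.2 hpos.le) ht⟩
    have h2 : ‖∑ i, s i • X i‖ ≤ ‖∑ i, (‖t‖⁻¹ • t) i • X i‖ := hmin hmem
    have h3 : ∑ i, (‖t‖⁻¹ • t) i • X i = ‖t‖⁻¹ • ∑ i, t i • X i := by
      simp [Finset.smul_sum, smul_smul]
    rw [h3, norm_smul, norm_inv, norm_norm] at h2
    rw [inv_mul_eq_div, le_div_iff₀ hspos]
    rwa [inv_mul_eq_div, le_div_iff₀ hpos, mul_comm] at h2

/-- The image of Lebesgue measure on the nonnegative orthant under `t ↦ ∑ i, t i • X i` is finite on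
compact sets. -/
theorem isFiniteMeasureOnCompacts_map [MeasurableSpace V] [BorelSpace V]
    {X : Fin m → V} (hX : ∀ i, X i ≠ 0) (hC : GeneratesPointedCone X) :
    IsFiniteMeasureOnCompacts (((volume : Measure (Fin m → ℝ)).restrict (Set.Ici 0)).map
      fun t => ∑ i, t i • X i) where
  lt_top_of_isCompact K hK := by
    obtain ⟨C, hC⟩ := exists_norm_le hX hC
    obtain ⟨R, hR⟩ := hK.isBounded.exists_norm_le
    have hm := (continuous_sum_smul X).measurable
    rw [Measure.map_apply hm hK.measurableSet, Measure.restrict_apply (hm hK.measurableSet)]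
    refine lt_of_le_of_lt (measure_mono ?_)
      (measure_closedBall_lt_top (x := (0 : Fin m → ℝ)) (r := |C| * R))
    rintro t ⟨htK, ht⟩
    rw [mem_closedBall_zero_iff]
    calc ‖t‖ ≤ C * ‖∑ i, t i • X i‖ := hC t ht
      _ ≤ |C| * ‖∑ i, t i • X i‖ := by gcongr; exact le_abs_self C
      _ ≤ |C| * R := by gcongr; exact hR _ htK

/-- The integral over the orthant defining the multivariate spline converges and is continuous and
linear in the test function. -/
theorem exists_spline [FiniteDimensional ℝ V] {X : Fin m → V} (hX : ∀ i, X i ≠ 0)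
    (hC : GeneratesPointedCone X) :
    ∃ T : 𝓓((⊤ : Opens V), ℝ) →L[ℝ] ℝ, ∀ φ : 𝓓((⊤ : Opens V), ℝ),
      IntegrableOn (fun t : Fin m → ℝ => φ (∑ i, t i • X i)) (Set.Ici 0) ∧
      T φ = ∫ t in Set.Ici (0 : Fin m → ℝ), φ (∑ i, t i • X i) := by
  let _ : MeasurableSpace V := borel V
  have _ : BorelSpace V := ⟨rfl⟩
  have : ProperSpace V := FiniteDimensional.proper ℝ V
  have := isFiniteMeasureOnCompacts_map hX hC
  have hm := (continuous_sum_smul X).measurable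
  set μ := ((volume : Measure (Fin m → ℝ)).restrict (Set.Ici 0)).map
      fun t => ∑ i, t i • X i with hμ
  have hloc : LocallyIntegrableOn (fun _ : V => (1 : ℝ)) ((⊤ : Opens V) : Set V) μ :=
    (continuous_const.locallyIntegrable).locallyIntegrableOn _
  refine ⟨TestFunction.integralAgainstBilinCLM (ContinuousLinearMap.mul ℝ ℝ) μ (fun _ => 1),
    fun φ => ⟨?_, ?_⟩⟩
  · have := φ.integrable hloc
    rw [hμ, integrable_map_measure φ.continuous.aestronglyMeasurable hm.aemeasurable] at this
    exact this
  · rw [TestFunction.integralAgainstBilinCLM_eq_integral hloc, hμ,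
      integral_map hm.aemeasurable]
    · simp
    · simpa using φ.continuous.aestronglyMeasurable

/-- The multivariate spline `T_X`: the distribution
`φ ↦ ∫_0^∞ ⋯ ∫_0^∞ φ(t_1 a_1 + ⋯ + t_m a_m) dt_1 ⋯ dt_m`, for a list `X = [a_1, …, a_m]` of nonzero
vectors that generates a pointed cone. -/
noncomputable def multivariateSpline [FiniteDimensional ℝ V] (X : Fin m → V)
    (hX : ∀ i, X i ≠ 0) (hC : GeneratesPointedCone X) : Distr V where
  toFun φ := ∫ t in Set.Ici (0 : Fin m → ℝ), φ (∑ i, t i • X i)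
  map_add' φ ψ := by
    obtain ⟨T, hT⟩ := exists_spline hX hC
    simp only [← (hT _).2, map_add]
  map_smul' c φ := by
    obtain ⟨T, hT⟩ := exists_spline hX hC
    simp only [← (hT _).2, map_smul, RingHom.id_apply]
  cont := by
    obtain ⟨T, hT⟩ := exists_spline hX hC
    exact T.continuous.congr fun φ => (hT φ).2

end Distributions

end BigCell

/-! For a sublist `S` let `T_S` be its spline, the image of Lebesgue measure on the face of the
orthant with coordinates in `S`. Pointedness makes `t ↦ ∑ t_i a_i` proper on the orthant, so all
integrals converge.

Two integrations by parts drive the argument. In the coordinate `t_i`, the fundamental theorem of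
calculus gives `∂_{a_i} T_S = T_{S∖i}` (`splineIntegral_fderiv`). With the weight `t_i`, it gives
the homogeneity of `T_S` (`splineIntegral_fderiv_self`). If `S` spans, write `x = ∑ l_i(x) a_i` with
linear forms `l_i`; combining the two yields `(|S| - dim V) T_S = ∑ l_i T_{S∖i}`
(`splineIntegral_euler`).

On a big cell `T_S` vanishes if `S` does not span and has a constant density if `S` is a basis.
Euler's formula then makes every `T_S` polynomial there, by induction on `S`. Let `P` be the
polynomial of `T_X`. For a cocircuit `Y`, the density `∂_Y P` agrees on the cell with `T_{X∖Y}`,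
which is zero there because `X∖Y` does not span. The cell is open and nonempty, so the analytic
function `∂_Y P` vanishes everywhere. -/

namespace BigCell

/-! ### Lebesgue measures on the faces of the orthant. -/

section OrthantMeasure

variable {m : ℕ}

/-- Lebesgue measure on the nonnegative half-line if `i ∈ S`, the Dirac measure at `0` otherwise. -/
noncomputable def rayMeasure (S : Finset (Fin m)) (i : Fin m) : Measure ℝ :=
  if i ∈ S then volume.restrict (Set.Ici 0) else Measure.dirac 0

instance (S : Finset (Fin m)) (i : Fin m) : SigmaFinite (rayMeasure S i) := by
  unfold rayMeasure; split_ifs <;> infer_instance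

instance (S : Finset (Fin m)) (i : Fin m) : IsLocallyFiniteMeasure (rayMeasure S i) := by
  unfold rayMeasure; split_ifs <;> infer_instance

/-- Lebesgue measure on the face of the nonnegative orthant spanned by the coordinates in `S`. -/
noncomputable def orthantMeasure (S : Finset (Fin m)) : Measure (Fin m → ℝ) :=
  Measure.pi (rayMeasure S)

instance (S : Finset (Fin m)) : IsLocallyFiniteMeasure (orthantMeasure S) :=
  inferInstanceAs (IsLocallyFiniteMeasure (Measure.pi (rayMeasure S)))

theorem orthantMeasure_univ :
    orthantMeasure (Finset.univ : Finset (Fin m)) = volume.restrict (Set.Ici 0) := by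
  have : (Set.Ici 0 : Set (Fin m → ℝ)) = Set.univ.pi fun _ => Set.Ici 0 := by
    rw [Set.pi_univ_Ici]; rfl
  rw [this, volume_pi, Measure.restrict_pi_pi]
  unfold orthantMeasure
  congr 1
  ext1 i
  simp [rayMeasure]

theorem ae_orthantMeasure (S : Finset (Fin m)) :
    ∀ᵐ t ∂orthantMeasure S, 0 ≤ t ∧ ∀ i ∉ S, t i = 0 := by
  have h : ∀ i, ∀ᵐ s ∂rayMeasure S i, 0 ≤ s ∧ (i ∉ S → s = 0) := by
    intro i
    unfold rayMeasure
    split_ifs with hi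
    · filter_upwards [ae_restrict_mem measurableSet_Ici] with s hs using ⟨hs, fun h => (h hi).elim⟩
    · rw [ae_dirac_eq]; simp
  have h' : ∀ᵐ t ∂orthantMeasure S, ∀ i, 0 ≤ t i ∧ (i ∉ S → t i = 0) :=
    ae_all_iff.2 fun i => (Measure.tendsto_eval_ae_ae (μ := rayMeasure S)).eventually (h i)
  filter_upwards [h'] with t ht using ⟨fun i => (ht i).1, fun i => (ht i).2⟩

theorem measurePreserving_orthantMeasure {n : ℕ} (S : Finset (Fin (n + 1))) (i : Fin (n + 1)) :
    MeasurePreserving (MeasurableEquiv.piFinSuccAbove (fun _ => ℝ) i).symm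
      ((rayMeasure S i).prod (Measure.pi fun j => rayMeasure S (i.succAbove j)))
      (orthantMeasure S) :=
  (measurePreserving_piFinSuccAbove (rayMeasure S) i).symm _

/-- The fundamental theorem of calculus in the coordinate `i`, integrated over an orthant. -/
theorem integral_fderiv_single_orthantMeasure {S : Finset (Fin m)} {i : Fin m} (hi : i ∈ S)
    {H : (Fin m → ℝ) → ℝ} (hH : ContDiff ℝ 1 H)
    (hint : Integrable (fun t => fderiv ℝ H t (Pi.single i 1)) (orthantMeasure S))
    (hsupp : ∀ t, HasCompactSupport fun s : ℝ => H (t + s • Pi.single i 1)) :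
    ∫ t, fderiv ℝ H t (Pi.single i 1) ∂orthantMeasure S =
      -∫ t, H t ∂orthantMeasure (S.erase i) := by
  obtain _ | n := m
  · exact i.elim0
  have key : ∀ (s : ℝ) (r : Fin n → ℝ),
      (MeasurableEquiv.piFinSuccAbove (fun _ => ℝ) i).symm (s, r) =
        i.insertNth 0 r + s • Pi.single i 1 := by
    intro s r
    ext j
    refine Fin.succAboveCases i ?_ (fun k => ?_) j <;>
      simp [MeasurableEquiv.piFinSuccAbove, Fin.insertNthEquiv]
  -- Erasing `i` only replaces the half-line factor at `i` by the Dirac mass at `0`, which evaluates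
  -- the boundary term.
  have hrest : (fun j => rayMeasure (S.erase i) (i.succAbove j)) =
      fun j => rayMeasure S (i.succAbove j) := by
    ext1 j
    simp [rayMeasure, Fin.succAbove_ne]
  have hS : rayMeasure S i = volume.restrict (Set.Ici 0) := by simp [rayMeasure, hi]
  have hSe : rayMeasure (S.erase i) i = Measure.dirac 0 := by simp [rayMeasure]
  have e1 := measurePreserving_orthantMeasure S i
  have e2 := measurePreserving_orthantMeasure (S.erase i) i
  rw [hrest, hSe, Measure.dirac_prod] at e2
  rw [hS] at e1
  rw [← e1.integral_comp (MeasurableEquiv.measurableEmbedding _),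
    ← e2.integral_comp (MeasurableEquiv.measurableEmbedding _), integral_prod_symm,
    integral_map measurable_prodMk_left.aemeasurable, ← integral_neg]
  · congr 1 with r
    simp only [key, zero_smul, add_zero]
    have hline : ContDiff ℝ 1 fun s : ℝ => (i.insertNth 0 r : Fin (n + 1) → ℝ) +
        s • (Pi.single i 1 : Fin (n + 1) → ℝ) := by fun_prop
    have := (hsupp (i.insertNth 0 r)).integral_Ioi_deriv_eq (hH.comp hline) 0
    rw [integral_Ici_eq_integral_Ioi]
    refine Eq.trans (integral_congr_ae (.of_forall fun s => ?_)) (this.trans (by simp))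
    have h1 : HasDerivAt (fun s : ℝ => (i.insertNth 0 r : Fin (n + 1) → ℝ) +
        s • (Pi.single i 1 : Fin (n + 1) → ℝ)) (Pi.single i 1) s := by
      simpa using ((hasDerivAt_id s).smul_const (Pi.single i 1 : Fin (n + 1) → ℝ)).const_add
        (i.insertNth 0 r : Fin (n + 1) → ℝ)
    exact (((hH.differentiable one_ne_zero _).hasFDerivAt).comp_hasDerivAt s h1).deriv.symm
  · exact (hH.continuous.stronglyMeasurable.comp_measurable
      (MeasurableEquiv.measurable _)).aestronglyMeasurable
  · exact (e1.integrable_comp_emb (MeasurableEquiv.measurableEmbedding _)).2 hint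

end OrthantMeasure

/-! ### Splines of sublists: derivatives, homogeneity, Euler's formula. -/

section Spline

variable {V : Type*} [NormedAddCommGroup V] [NormedSpace ℝ V] {m : ℕ} {X : Fin m → V}

/-- By pointedness `‖t‖` is bounded by a multiple of `‖∑ t_i a_i‖` on the orthant, so the preimage
of a compact set there is bounded. -/
theorem integrable_orthantMeasure (hX : ∀ i, X i ≠ 0) (hC : GeneratesPointedCone X)
    (S : Finset (Fin m)) {F : (Fin m → ℝ) → ℝ} (hF : Continuous F) {φ : V → ℝ}
    (hφ : HasCompactSupport φ) (hFφ : ∀ t, ∑ i, t i • X i ∉ tsupport φ → F t = 0) :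
    Integrable F (orthantMeasure S) := by
  obtain ⟨C, hC⟩ := exists_norm_le hX hC
  obtain ⟨R, hR⟩ := hφ.isCompact.isBounded.exists_norm_le
  refine IntegrableOn.integrable_of_ae_notMem_eq_zero (s := Metric.closedBall 0 (|C| * R))
    (hF.continuousOn.integrableOn_compact (isCompact_closedBall _ _)) ?_
  filter_upwards [ae_orthantMeasure S] with t ht htR
  refine hFφ t fun htφ => htR ?_
  rw [mem_closedBall_zero_iff]
  calc ‖t‖ ≤ C * ‖∑ i, t i • X i‖ := hC t ht.1
    _ ≤ |C| * ‖∑ i, t i • X i‖ := by gcongr; exact le_abs_self C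
    _ ≤ |C| * R := by gcongr; exact hR _ htφ

/-- The linear map `t ↦ ∑ i, t i • X i`. -/
noncomputable def sumSMul (X : Fin m → V) : (Fin m → ℝ) →L[ℝ] V :=
  ∑ i, (ContinuousLinearMap.proj i : (Fin m → ℝ) →L[ℝ] ℝ).smulRight (X i)

theorem sumSMul_apply (X : Fin m → V) (t : Fin m → ℝ) : sumSMul X t = ∑ i, t i • X i := by
  simp [sumSMul]

theorem sumSMul_single (X : Fin m → V) (i : Fin m) : sumSMul X (Pi.single i 1) = X i := by
  simp [sumSMul_apply, Pi.single_apply, ite_smul]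

/-- The multivariate spline of the sublist of `X` with index set `S`, at the test function `φ`. -/
noncomputable def splineIntegral (X : Fin m → V) (S : Finset (Fin m)) (φ : V → ℝ) : ℝ :=
  ∫ t, φ (sumSMul X t) ∂orthantMeasure S

/-- Since `X i ≠ 0`, the coordinate line is sent to a closed embedded line. Compactness is only
claimed along such lines: the pullback of `φ` to the whole parameter space need not have compact
support. -/
theorem hasCompactSupport_comp_line (hX : ∀ i, X i ≠ 0) (i : Fin m) {φ : V → ℝ}
    (hφ : HasCompactSupport φ) (t : Fin m → ℝ) :
    HasCompactSupport fun s : ℝ => φ (sumSMul X (t + s • Pi.single i 1)) := by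
  have h : Topology.IsClosedEmbedding fun s : ℝ => sumSMul X t + s • X i :=
    (Homeomorph.addLeft (sumSMul X t)).isClosedEmbedding.comp
      (isClosedEmbedding_smul_left (hX i))
  have := hφ.comp_isClosedEmbedding h
  simpa [Function.comp_def, sumSMul_single] using this

theorem integrable_spline (hX : ∀ i, X i ≠ 0) (hC : GeneratesPointedCone X)
    (S : Finset (Fin m)) {φ : V → ℝ} (hc : Continuous φ) (hφ : HasCompactSupport φ) :
    Integrable (fun t => φ (sumSMul X t)) (orthantMeasure S) :=
  integrable_orthantMeasure hX hC S (hc.comp (sumSMul X).continuous) hφ fun t ht =>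
    image_eq_zero_of_notMem_tsupport (by rwa [sumSMul_apply])

theorem fderiv_comp_sumSMul {φ : V → ℝ} (hd : ContDiff ℝ 1 φ) (t v : Fin m → ℝ) :
    fderiv ℝ (fun t => φ (sumSMul X t)) t v = fderiv ℝ φ (sumSMul X t) (sumSMul X v) := by
  have := (hd.differentiable one_ne_zero (sumSMul X t)).hasFDerivAt.comp t
    (sumSMul X).hasFDerivAt
  exact congr($(this.fderiv) v)

/-- The derivative of the spline of `S` along `X i` is the spline of `S.erase i`. -/
theorem splineIntegral_fderiv (hX : ∀ i, X i ≠ 0) (hC : GeneratesPointedCone X)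
    {S : Finset (Fin m)} {i : Fin m} (hi : i ∈ S) {φ : V → ℝ} (hd : ContDiff ℝ 1 φ)
    (hφ : HasCompactSupport φ) :
    splineIntegral X S (fun x => fderiv ℝ φ x (X i)) = -splineIntegral X (S.erase i) φ := by
  have hd' : ContDiff ℝ 1 fun t => φ (sumSMul X t) := hd.comp (sumSMul X).contDiff
  have h := integral_fderiv_single_orthantMeasure (H := fun t => φ (sumSMul X t)) hi hd' ?_
    (hasCompactSupport_comp_line hX i hφ)
  · simp only [fderiv_comp_sumSMul hd, sumSMul_single] at h
    exact h
  · simp only [fderiv_comp_sumSMul hd, sumSMul_single]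
    exact integrable_spline hX hC S ((hd.continuous_fderiv one_ne_zero).clm_apply continuous_const)
      (hφ.fderiv_apply ℝ (X i))

theorem integrable_coord_mul_fderiv (hX : ∀ i, X i ≠ 0) (hC : GeneratesPointedCone X)
    (S : Finset (Fin m)) (i : Fin m) {φ : V → ℝ} (hd : ContDiff ℝ 1 φ)
    (hφ : HasCompactSupport φ) :
    Integrable (fun t => t i * fderiv ℝ φ (sumSMul X t) (X i)) (orthantMeasure S) := by
  refine integrable_orthantMeasure hX hC S ?_ (hφ.fderiv_apply ℝ (X i)) fun t ht => ?_
  · exact (continuous_apply i).mul (((hd.continuous_fderiv one_ne_zero).comp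
      (sumSMul X).continuous).clm_apply continuous_const)
  · have := image_eq_zero_of_notMem_tsupport ht
    rw [← sumSMul_apply] at this
    rw [this, mul_zero]

/-- Integration by parts in `t_i`: the boundary term lives on the face `t_i = 0`, where the weight
`t_i` vanishes. -/
theorem integral_coord_mul_fderiv (hX : ∀ i, X i ≠ 0) (hC : GeneratesPointedCone X)
    {S : Finset (Fin m)} {i : Fin m} (hi : i ∈ S) {φ : V → ℝ} (hd : ContDiff ℝ 1 φ)
    (hφ : HasCompactSupport φ) :
    ∫ t, t i * fderiv ℝ φ (sumSMul X t) (X i) ∂orthantMeasure S = -splineIntegral X S φ := by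
  have hd' : ContDiff ℝ 1 fun t => φ (sumSMul X t) := hd.comp (sumSMul X).contDiff
  have hH : ContDiff ℝ 1 fun t : Fin m → ℝ => t i * φ (sumSMul X t) :=
    (contDiff_apply ℝ ℝ i).mul hd'
  have hderiv : ∀ t, fderiv ℝ (fun t : Fin m → ℝ => t i * φ (sumSMul X t)) t (Pi.single i 1) =
      t i * fderiv ℝ φ (sumSMul X t) (X i) + φ (sumSMul X t) := by
    intro t
    have := (hasFDerivAt_apply (𝕜 := ℝ) i t).mul
      (hd'.differentiable one_ne_zero t).hasFDerivAt
    have := congr($(this.fderiv) (Pi.single i 1))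
    refine this.trans ?_
    simp [fderiv_comp_sumSMul hd, sumSMul_single]
  have hint1 := integrable_coord_mul_fderiv hX hC S i hd hφ
  have hint2 := integrable_spline hX hC S hd.continuous hφ
  have h := integral_fderiv_single_orthantMeasure hi hH ?_ ?_
  · simp only [hderiv] at h
    rw [integral_add hint1 hint2] at h
    have h0 : ∫ t, t i * φ (sumSMul X t) ∂orthantMeasure (S.erase i) = 0 := by
      refine integral_eq_zero_of_ae ?_
      filter_upwards [ae_orthantMeasure (S.erase i)] with t ht
      simp [ht.2 i]
    rw [h0] at h
    unfold splineIntegral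
    linarith
  · simp only [hderiv]
    exact hint1.add hint2
  · exact fun t => (hasCompactSupport_comp_line hX i hφ t).mul_left

/-- Homogeneity of the spline, in infinitesimal form. -/
theorem splineIntegral_fderiv_self (hX : ∀ i, X i ≠ 0) (hC : GeneratesPointedCone X)
    (S : Finset (Fin m)) {φ : V → ℝ} (hd : ContDiff ℝ 1 φ) (hφ : HasCompactSupport φ) :
    splineIntegral X S (fun x => fderiv ℝ φ x x) = -(S.card * splineIntegral X S φ) := by
  have h : ∫ t, ∑ i ∈ S, t i * fderiv ℝ φ (sumSMul X t) (X i) ∂orthantMeasure S =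
      -(S.card * splineIntegral X S φ) := by
    rw [integral_finsetSum _ fun i _ => integrable_coord_mul_fderiv hX hC S i hd hφ,
      Finset.sum_congr rfl fun i hi => integral_coord_mul_fderiv hX hC hi hd hφ]
    simp
  rw [← h]
  refine integral_congr_ae ?_
  filter_upwards [ae_orthantMeasure S] with t ht
  conv_lhs => rw [show fderiv ℝ φ (sumSMul X t) (sumSMul X t) =
    ∑ i, t i * fderiv ℝ φ (sumSMul X t) (X i) by
      rw [sumSMul_apply, map_sum]; simp]
  exact (Finset.sum_subset (Finset.subset_univ S) fun i _ hi => by simp [ht.2 i hi]).symm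

theorem splineIntegral_congr {S : Finset (Fin m)} {φ ψ : V → ℝ}
    (h : ∀ x ∈ cone X S, φ x = ψ x) : splineIntegral X S φ = splineIntegral X S ψ := by
  refine integral_congr_ae ?_
  filter_upwards [ae_orthantMeasure S] with t ht
  refine h _ ?_
  rw [sumSMul_apply, ← Finset.sum_subset (Finset.subset_univ S)
    fun i _ hi => by simp [ht.2 i hi]]
  exact Submodule.sum_mem (cone X S) fun i hi =>
    PointedCone.smul_mem _ (ht.1 i) (PointedCone.subset_hull ⟨i, hi, rfl⟩)

/-- The spline is carried by the cone of `S`, which consists of singular vectors when `S` does not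
span. -/
theorem splineIntegral_eq_zero {S : Finset (Fin m)} (hS : ¬ Spans X S) {φ : V → ℝ}
    (hφ : tsupport φ ⊆ (singularVectors X)ᶜ) : splineIntegral X S φ = 0 := by
  rw [splineIntegral_congr (ψ := 0)]
  · simp [splineIntegral]
  · intro x hx
    refine image_eq_zero_of_notMem_tsupport fun h => hφ h ?_
    exact Set.mem_biUnion (x := S) hS hx

/-- Euler's formula expressing a spline through the splines of the sublists obtained by
deleting one vector. -/
theorem splineIntegral_euler [FiniteDimensional ℝ V] (hX : ∀ i, X i ≠ 0)
    (hC : GeneratesPointedCone X) {S : Finset (Fin m)} {l : Fin m → V →L[ℝ] ℝ}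
    (hl : ∀ x, ∑ i ∈ S, l i x • X i = x) {φ : V → ℝ} (hd : ContDiff ℝ 1 φ)
    (hφ : HasCompactSupport φ) :
    ((S.card : ℝ) - Module.finrank ℝ V) * splineIntegral X S φ =
      ∑ i ∈ S, splineIntegral X (S.erase i) (fun x => l i x * φ x) := by
  -- The trace of `∑ l_i ⊗ a_i = id`; this is the source of the dimension in the formula.
  have htrace : ∑ i ∈ S, l i (X i) = Module.finrank ℝ V := by
    have : ∑ i ∈ S, (l i : V →ₗ[ℝ] ℝ).smulRight (X i) = LinearMap.id := by
      ext x; simpa using hl x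
    rw [← LinearMap.trace_id, ← this, map_sum]
    simp only [LinearMap.trace_smulRight]
    rfl
  have hprod : ∀ i, ContDiff ℝ 1 fun x => l i x * φ x := fun i => (l i).contDiff.mul hd
  have hderiv : ∀ i x, fderiv ℝ (fun x => l i x * φ x) x (X i) =
      l i x * fderiv ℝ φ x (X i) + l i (X i) * φ x := by
    intro i x
    have := (l i).hasFDerivAt.mul (hd.differentiable one_ne_zero x).hasFDerivAt
    refine congr($(this.fderiv) (X i)).trans ?_
    simp [mul_comm]
  -- The Euler field applied to `φ`, rewritten as a sum of derivatives along the `a_i`, to which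
  -- `splineIntegral_fderiv` applies.
  have hsum : ∀ x, fderiv ℝ φ x x =
      ∑ i ∈ S, fderiv ℝ (fun x => l i x * φ x) x (X i) - Module.finrank ℝ V * φ x := by
    intro x
    simp only [hderiv, Finset.sum_add_distrib, ← Finset.sum_mul, htrace]
    conv_lhs => rw [show fderiv ℝ φ x x = fderiv ℝ φ x (∑ i ∈ S, l i x • X i) by rw [hl]]
    simp
  have h1 := splineIntegral_fderiv_self hX hC S hd hφ
  have hint : ∀ i, Integrable (fun t => fderiv ℝ (fun x => l i x * φ x) (sumSMul X t) (X i))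
      (orthantMeasure S) := fun i =>
    integrable_spline hX hC S (((hprod i).continuous_fderiv one_ne_zero).clm_apply
      continuous_const) ((hφ.mul_left (f := l i)).fderiv_apply ℝ (X i))
  have h2 : splineIntegral X S (fun x => fderiv ℝ φ x x) =
      ∑ i ∈ S, splineIntegral X S (fun x => fderiv ℝ (fun x => l i x * φ x) x (X i)) -
        Module.finrank ℝ V * splineIntegral X S φ := by
    simp only [hsum, splineIntegral]
    rw [integral_sub (integrable_finsetSum _ fun i _ => hint i)
      ((integrable_spline hX hC S hd.continuous hφ).const_mul _),
      integral_finsetSum _ fun i _ => hint i, integral_const_mul]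
  rw [Finset.sum_congr rfl fun i hi =>
    splineIntegral_fderiv hX hC hi (hprod i) (hφ.mul_left (f := l i)),
    Finset.sum_neg_distrib] at h2
  linarith

theorem Spans.finrank_le_card {S : Finset (Fin m)} (hS : Spans X S) :
    Module.finrank ℝ V ≤ S.card := by
  classical
  have h1 := finrank_span_finset_le_card (S.image X) (R := ℝ)
  rw [Finset.coe_image, Set.finrank, show Submodule.span ℝ (X '' S) = ⊤ from hS, finrank_top] at h1
  exact h1.trans Finset.card_image_le

end Spline

/-! ### Polynomiality on connected sets of nonsingular vectors. -/

section Polynomial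

variable {V : Type*} [NormedAddCommGroup V] [NormedSpace ℝ V] [FiniteDimensional ℝ V] {m : ℕ}
  {X : Fin m → V}

theorem pi_dirac_zero (ι : Type*) [Fintype ι] :
    Measure.pi (fun _ : ι => Measure.dirac (0 : ℝ)) = Measure.dirac 0 := by
  refine Measure.pi_eq fun s hs => ?_
  rw [Measure.dirac_apply' _ (MeasurableSet.univ_pi hs)]
  simp only [Measure.dirac_apply' _ (hs _)]
  by_cases h : ∀ i, (0 : ℝ) ∈ s i
  · simp [Set.indicator, h]
  · have h0 : (0 : ι → ℝ) ∉ Set.univ.pi s := fun h' => h fun i => h' i trivial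
    push Not at h
    obtain ⟨i, hi⟩ := h
    rw [Set.indicator_of_notMem h0, Finset.prod_eq_zero (Finset.mem_univ i)]
    simp [hi]

/-- An integral over a face of the orthant only involves the coordinates along this face. -/
theorem integral_orthantMeasure_eq (S : Finset (Fin m)) {F : (Fin m → ℝ) → ℝ} (hF : Continuous F) :
    ∫ t, F t ∂orthantMeasure S =
      ∫ u in Set.Ici (0 : S → ℝ), F (fun i => if h : i ∈ S then u ⟨i, h⟩ else 0) := by
  have e := (measurePreserving_piEquivPiSubtypeProd (rayMeasure S) (· ∈ S)).symm
  have h1 : (Measure.pi fun i : {i // i ∈ S} => rayMeasure S i) =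
      volume.restrict (Set.Ici (0 : S → ℝ)) := by
    have : (Set.Ici 0 : Set (S → ℝ)) = Set.univ.pi fun _ => Set.Ici 0 := by
      rw [Set.pi_univ_Ici]; rfl
    rw [this, volume_pi, Measure.restrict_pi_pi]
    congr 1
    ext1 i
    simp [rayMeasure]
  have h2 : (Measure.pi fun i : {i // i ∉ S} => rayMeasure S i) = Measure.dirac 0 := by
    rw [← pi_dirac_zero]
    congr 1
    ext1 i
    simp [rayMeasure, i.2]
  have e : MeasurePreserving (MeasurableEquiv.piEquivPiSubtypeProd (fun _ => ℝ) (· ∈ S)).symm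
      ((volume.restrict (Set.Ici (0 : S → ℝ))).prod (Measure.dirac 0)) (orthantMeasure S) := by
    rw [← h1, ← h2]
    unfold orthantMeasure
    convert e
    rfl
  rw [Measure.prod_dirac] at e
  rw [← e.integral_comp (MeasurableEquiv.measurableEmbedding _),
    integral_map measurable_prodMk_right.aemeasurable]
  · rfl
  · exact (hF.stronglyMeasurable.comp_measurable
      (MeasurableEquiv.measurable _)).aestronglyMeasurable

/-- If `S` is a basis, its spline has a constant density on a connected set of nonsingular vectors,
which lies either inside the cone generated by `S` or outside of it. -/
theorem exists_splineIntegral_eq_const_mul [MeasurableSpace V] [BorelSpace V] (dx : Measure V)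
    [dx.IsAddHaarMeasure] {c : Set V} (hc : IsPreconnected c) (hcs : c ⊆ (singularVectors X)ᶜ)
    {S : Finset (Fin m)} (hS : Spans X S) (hcard : S.card = Module.finrank ℝ V) :
    ∃ k : ℝ, ∀ φ : V → ℝ, Continuous φ → tsupport φ ⊆ c →
      splineIntegral X S φ = k * ∫ x, φ x ∂dx := by
  classical
  have hspan : ⊤ ≤ Submodule.span ℝ (Set.range fun i : S => X i) := by
    have : (Set.range fun i : S => X i) = X '' S := (Set.image_eq_range X S).symm
    rw [this, hS]
  set b := basisOfTopLeSpanOfCardEqFinrank (fun i : S => X i) hspan (by simpa using hcard) with hb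
  have hb' : ∀ i, b i = X i := fun i => by simp [hb]
  set e : V ≃L[ℝ] (S → ℝ) := b.equivFunL
  have hes : ∀ u, e.symm u = ∑ i, u i • X i := fun u => by
    have : e.symm u = b.equivFun.symm u := rfl
    rw [this, b.equivFun_symm_apply]
    simp only [hb']
  have hsum : ∀ x, ∑ i, e x i • X i = x := fun x => by rw [← hes, e.symm_apply_apply]
  have hspline : ∀ φ : V → ℝ, Continuous φ →
      splineIntegral X S φ = ∫ u in Set.Ici (0 : S → ℝ), φ (e.symm u) := by
    intro φ hφ
    refine (integral_orthantMeasure_eq S (hφ.comp (sumSMul X).continuous)).trans ?_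
    congr 1 with u
    rw [Function.comp_apply, sumSMul_apply, hes, ← Finset.sum_subset (Finset.subset_univ S)
      fun i _ hi => by simp [hi], ← Finset.sum_coe_sort]
    simp
  -- Otherwise all coordinates are nonnegative and some coordinate `j` is zero, so `x` lies in the
  -- cone of `S.erase j`, too short a list to span.
  have hcover : c ⊆ {x | ∀ i, 0 < e x i} ∪ {x | ∃ i, e x i < 0} := by
    intro x hx
    by_contra hne
    simp only [Set.mem_union, Set.mem_ofPred_eq, not_or, not_forall, not_exists, not_lt] at hne
    obtain ⟨⟨j, hj⟩, hpos⟩ := hne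
    have hj0 : e x j = 0 := le_antisymm hj (hpos j)
    refine hcs hx (Set.mem_biUnion (x := S.erase j) (fun hsp => ?_) ?_)
    · have h1 := finrank_span_finset_le_card ((S.erase (j : Fin m)).image X) (R := ℝ)
      rw [Finset.coe_image, Set.finrank, hsp, finrank_top] at h1
      have h2 := (Finset.card_image_le (s := S.erase (j : Fin m)) (f := X))
      have h3 := Finset.card_erase_lt_of_mem j.2
      omega
    · rw [← hsum x]
      refine Submodule.sum_mem (cone X (S.erase j)) fun i _ => ?_
      by_cases hij : i = j
      · rw [hij, hj0, zero_smul]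
        exact zero_mem _
      · exact PointedCone.smul_mem _ (hpos i) (PointedCone.subset_hull
          ⟨i, by simp [hij], rfl⟩)
  have hopen1 : IsOpen {x | ∀ i, 0 < e x i} := by
    rw [Set.ofPred_forall]
    exact isOpen_iInter_of_finite fun i =>
      isOpen_lt continuous_const ((continuous_apply i).comp e.continuous)
  have hopen2 : IsOpen {x | ∃ i, e x i < 0} := by
    rw [Set.ofPred_exists]
    exact isOpen_iUnion fun i =>
      isOpen_lt ((continuous_apply i).comp e.continuous) continuous_const
  have hdisj : Disjoint {x | ∀ i, 0 < e x i} {x | ∃ i, e x i < 0} :=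
    Set.disjoint_left.2 fun x h1 ⟨i, hi⟩ => lt_asymm hi (h1 i)
  rcases hc.subset_or_subset hopen1 hopen2 hdisj hcover with hin | hout
  · have hmap : ((volume : Measure (S → ℝ)).map e.symm).IsAddHaarMeasure :=
      e.symm.isAddHaarMeasure_map volume
    -- The constant compares `dx` with the Lebesgue measure of the coordinates in the basis `S`.
    refine ⟨((volume : Measure (S → ℝ)).map e.symm).addHaarScalarFactor dx, fun φ hφ hsupp => ?_⟩
    rw [hspline φ hφ, setIntegral_eq_integral_of_forall_compl_eq_zero]
    · rw [← integral_map (μ := volume) e.symm.continuous.aemeasurable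
        hφ.aestronglyMeasurable]
      conv_lhs => rw [Measure.isAddLeftInvariant_eq_smul
        ((volume : Measure (S → ℝ)).map e.symm) dx]
      rw [integral_smul_nnreal_measure]
      rfl
    · intro u hu
      refine image_eq_zero_of_notMem_tsupport fun h => hu fun i => ?_
      have := hin (hsupp h) i
      rw [e.apply_symm_apply] at this
      exact this.le
  · refine ⟨0, fun φ hφ hsupp => ?_⟩
    rw [hspline φ hφ, zero_mul]
    refine setIntegral_eq_zero_of_forall_eq_zero fun u hu => ?_
    refine image_eq_zero_of_notMem_tsupport fun h => ?_
    obtain ⟨i, hi⟩ := hout (hsupp h)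
    rw [e.apply_symm_apply] at hi
    exact absurd (hu i) (not_le.2 hi)

/-- A linear section of the surjection `t ↦ ∑ t_i a_i`. `S` may be larger than a basis, as Euler's
formula requires in order to be useful. -/
theorem Spans.exists_coord {S : Finset (Fin m)} (hS : Spans X S) :
    ∃ l : Fin m → V →L[ℝ] ℝ, ∀ x, ∑ i ∈ S, l i x • X i = x := by
  let L : (Fin m → ℝ) →ₗ[ℝ] V := ∑ i ∈ S, (LinearMap.proj i).smulRight (X i)
  have hL : ∀ t, L t = ∑ i ∈ S, t i • X i := fun t => by simp [L]
  have hsurj : LinearMap.range L = ⊤ := by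
    rw [eq_top_iff, ← show _ = ⊤ from hS, Submodule.span_le]
    rintro _ ⟨i, hi, rfl⟩
    refine ⟨Pi.single i 1, ?_⟩
    rw [hL, Finset.sum_eq_single i (fun j _ hj => by simp [hj]) (fun h => (h hi).elim)]
    simp
  obtain ⟨g, hg⟩ := L.exists_rightInverse_of_surjective hsurj
  refine ⟨fun i => LinearMap.toContinuousLinearMap (LinearMap.proj i ∘ₗ g), fun x => ?_⟩
  have := congr($hg x)
  simpa [hL] using this

theorem analyticOnNhd_eval (P : MvPolynomial (Module.Dual ℝ V) ℝ) :
    AnalyticOnNhd ℝ (fun x : V => MvPolynomial.eval (fun l => l x) P) Set.univ := by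
  have := AnalyticOnNhd.aeval_mvPolynomial (𝕜 := ℝ) (A := ℝ) (B := ℝ) (s := Set.univ)
    (f := fun (x : V) (l : Module.Dual ℝ V) => l x)
    (fun l => (LinearMap.toContinuousLinearMap l).analyticOnNhd _) P
  simpa [MvPolynomial.coe_aeval_eq_eval] using this

/-- Every spline of a sublist of `X` is given by a polynomial on a connected set of nonsingular
vectors. -/
theorem exists_splineIntegral_eq_integral_eval [MeasurableSpace V] [BorelSpace V] (dx : Measure V)
    [dx.IsAddHaarMeasure] (hX : ∀ i, X i ≠ 0) (hC : GeneratesPointedCone X) {c : Set V}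
    (hc : IsPreconnected c) (hcs : c ⊆ (singularVectors X)ᶜ) (S : Finset (Fin m)) :
    ∃ P : MvPolynomial (Module.Dual ℝ V) ℝ, ∀ φ : V → ℝ, ContDiff ℝ 1 φ → HasCompactSupport φ →
      tsupport φ ⊆ c →
        splineIntegral X S φ = ∫ x, MvPolynomial.eval (fun l => l x) P * φ x ∂dx := by
  induction S using Finset.strongInduction with
  | H S ih =>
    by_cases hS : Spans X S
    swap
    · exact ⟨0, fun φ _ _ hφ => by simp [splineIntegral_eq_zero hS (hφ.trans hcs)]⟩
    rcases hS.finrank_le_card.eq_or_lt with hcard | hcard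
    · obtain ⟨k, hk⟩ := exists_splineIntegral_eq_const_mul dx hc hcs hS hcard.symm
      exact ⟨MvPolynomial.C k, fun φ hd _ hφ => by
        simp [hk φ hd.continuous hφ, integral_const_mul]⟩
    obtain ⟨l, hl⟩ := hS.exists_coord
    -- Each `P i` works for all test functions supported in `c`, hence for `l i * φ`, whose support
    -- lies in that of `φ`.
    choose! P hP using fun i (hi : i ∈ S) => ih (S.erase i) (Finset.erase_ssubset hi)
    have hpos : (0 : ℝ) < S.card - Module.finrank ℝ V := sub_pos.2 (by exact_mod_cast hcard)
    refine ⟨MvPolynomial.C ((S.card : ℝ) - Module.finrank ℝ V)⁻¹ *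
      ∑ i ∈ S, P i * MvPolynomial.X (l i : V →ₗ[ℝ] ℝ), fun φ hd hφ hsupp => ?_⟩
    have hcont : ∀ i, Continuous fun x : V => MvPolynomial.eval (fun l => l x) (P i) := fun i =>
      continuousOn_univ.1 (analyticOnNhd_eval (P i)).continuousOn
    have hint : ∀ i ∈ S, Integrable
        (fun x => MvPolynomial.eval (fun l => l x) (P i) * (l i x * φ x)) dx := fun i _ =>
      ((hcont i).mul ((l i).continuous.mul hd.continuous)).integrable_of_hasCompactSupport
        ((hφ.mul_left (f := l i)).mul_left)
    have heuler := splineIntegral_euler hX hC hl hd hφ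
    rw [Finset.sum_congr rfl fun i hi => hP i hi _ ((l i).contDiff.mul hd)
      (hφ.mul_left (f := l i)) ((tsupport_mul_subset_right).trans hsupp),
      ← integral_finsetSum _ hint] at heuler
    rw [eq_comm, ← inv_mul_eq_iff_eq_mul₀ hpos.ne'] at heuler
    rw [← heuler, ← integral_const_mul]
    congr 1 with x
    simp [Finset.sum_mul, mul_assoc]

end Polynomial

/-! ### Closedness of the singular set. -/

section Cell

variable {V : Type*} [NormedAddCommGroup V] [NormedSpace ℝ V] {m : ℕ} {X : Fin m → V}

theorem coe_cone_eq_image (S : Finset (Fin m)) :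
    (cone X S : Set V) = sumSMul X '' {t | 0 ≤ t ∧ ∀ i ∉ S, t i = 0} := by
  refine Set.Subset.antisymm ?_ ?_
  · intro x hx
    induction hx using Submodule.span_induction with
    | mem x h =>
      obtain ⟨i, hi, rfl⟩ := h
      refine ⟨Pi.single i 1, ⟨by simp, fun j hj => ?_⟩, sumSMul_single X i⟩
      exact Pi.single_eq_of_ne (by rintro rfl; exact hj hi) _
    | zero => exact ⟨0, by simp⟩
    | add x y _ _ hx hy =>
      obtain ⟨s, hs, rfl⟩ := hx
      obtain ⟨t, ht, rfl⟩ := hy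
      exact ⟨s + t, ⟨add_nonneg hs.1 ht.1, fun i hi => by simp [hs.2 i hi, ht.2 i hi]⟩, map_add _ _ _⟩
    | smul a x _ hx =>
      obtain ⟨s, hs, rfl⟩ := hx
      exact ⟨(a : ℝ) • s, ⟨smul_nonneg a.2 hs.1, fun i hi => by simp [hs.2 i hi]⟩, map_smul _ _ _⟩
  · rintro _ ⟨t, ht, rfl⟩
    rw [sumSMul_apply, ← Finset.sum_subset (Finset.subset_univ S)
      fun i _ hi => by simp [ht.2 i hi]]
    exact Submodule.sum_mem (cone X S) fun i hi =>
      PointedCone.smul_mem _ (ht.1 i) (PointedCone.subset_hull ⟨i, hi, rfl⟩)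

/-- Properness again: points of the cone near `x` have coefficients in a fixed ball, so near `x` the
cone is contained in a compact image that is itself part of the cone. -/
theorem isClosed_cone (hX : ∀ i, X i ≠ 0) (hC : GeneratesPointedCone X) (S : Finset (Fin m)) :
    IsClosed (cone X S : Set V) := by
  obtain ⟨C, hC⟩ := exists_norm_le hX hC
  set K : Set (Fin m → ℝ) := {t | 0 ≤ t ∧ ∀ i ∉ S, t i = 0} with hK
  have hKc : IsClosed K := by
    have : K = Set.Ici 0 ∩ ⋂ i, ⋂ (_ : i ∉ S), {t | t i = 0} := by
      ext t; simp [hK]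
    rw [this]
    exact isClosed_Ici.inter (isClosed_iInter fun i => isClosed_iInter fun _ =>
      isClosed_eq (continuous_apply i) continuous_const)
  rw [coe_cone_eq_image]
  refine isClosed_of_closure_subset fun x hx => ?_
  have hcpt : IsCompact (sumSMul X '' (K ∩ Metric.closedBall 0 (|C| * (‖x‖ + 1)))) :=
    ((isCompact_closedBall _ _).inter_left hKc).image (sumSMul X).continuous
  have hx' : x ∈ closure (sumSMul X '' K ∩ Metric.ball x 1) :=
    mem_closure_iff_nhds.2 fun U hU => by
      obtain ⟨y, hy, hyK⟩ := mem_closure_iff_nhds.1 hx _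
        (Filter.inter_mem hU (Metric.ball_mem_nhds x one_pos))
      exact ⟨y, hy.1, hyK, hy.2⟩
  refine Set.image_mono Set.inter_subset_left (hcpt.isClosed.closure_subset_iff.2 ?_ hx')
  rintro _ ⟨⟨t, ht, rfl⟩, hball⟩
  refine ⟨t, ⟨ht, ?_⟩, rfl⟩
  rw [mem_closedBall_zero_iff]
  have hnorm : ‖sumSMul X t‖ ≤ ‖x‖ + 1 := by
    have h1 : ‖sumSMul X t - x‖ < 1 := mem_ball_iff_norm.1 hball
    have h2 := norm_sub_norm_le (sumSMul X t) x
    linarith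
  calc ‖t‖ ≤ C * ‖∑ i, t i • X i‖ := hC t ht.1
    _ ≤ |C| * ‖sumSMul X t‖ := by rw [sumSMul_apply]; gcongr; exact le_abs_self C
    _ ≤ |C| * (‖x‖ + 1) := by gcongr

theorem isClosed_singularVectors (hX : ∀ i, X i ≠ 0) (hC : GeneratesPointedCone X) :
    IsClosed (singularVectors X) :=
  (Set.toFinite _).isClosed_biUnion fun S _ => isClosed_cone hX hC S

end Cell

/-! ### Derivatives of splines and of analytic densities. -/

section Derivatives

variable {V : Type*} [NormedAddCommGroup V] [NormedSpace ℝ V] {m : ℕ} {X : Fin m → V}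

theorem coe_lineDerivOp (φ : 𝓓((⊤ : Opens V), ℝ)) (v : V) :
    ⇑(∂_{v} φ : 𝓓((⊤ : Opens V), ℝ)) = fun x => fderiv ℝ φ x v := by
  ext x
  rw [TestFunction.lineDerivOp_eq_lineDerivCLM ℝ, TestFunction.lineDerivCLM_eq_fderivCLM,
    TestFunction.fderivCLM_apply_of_le _ (by simp)]

theorem contDiff_one (φ : 𝓓((⊤ : Opens V), ℝ)) : ContDiff ℝ 1 φ :=
  φ.contDiff.of_le (by exact_mod_cast le_top)

theorem tsupport_lineDerivOp_subset (φ : 𝓓((⊤ : Opens V), ℝ)) (v : V) :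
    tsupport ⇑(∂_{v} φ : 𝓓((⊤ : Opens V), ℝ)) ⊆ tsupport φ := by
  rw [coe_lineDerivOp]
  exact tsupport_fderiv_apply_subset ℝ v

/-- Differentiating along distinct elements of the sublist `S` removes them from the spline. -/
theorem iteratedLineDerivOp_eq_splineIntegral (hX : ∀ i, X i ≠ 0) (hC : GeneratesPointedCone X)
    {c : Set V} {f : Distr V} {S : Finset (Fin m)}
    (hf : ∀ φ : 𝓓((⊤ : Opens V), ℝ), tsupport φ ⊆ c → f φ = splineIntegral X S φ)
    {k : ℕ} (g : Fin k → Fin m) (hg : Function.Injective g) (hgS : ∀ j, g j ∈ S)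
    (φ : 𝓓((⊤ : Opens V), ℝ)) (hφ : tsupport φ ⊆ c) :
    (∂^{fun j => X (g j)} f) φ = splineIntegral X (S \ Finset.univ.image g) φ := by
  induction k generalizing φ with
  | zero => simpa using hf φ hφ
  | succ k ih =>
    have hmem : g 0 ∈ S \ Finset.univ.image fun j : Fin k => g j.succ := by
      simp only [Finset.mem_sdiff, Finset.mem_image, Finset.mem_univ, true_and, not_exists]
      exact ⟨hgS 0, fun j hj => Fin.succ_ne_zero j (hg hj)⟩
    have herase : (S \ Finset.univ.image fun j : Fin k => g j.succ).erase (g 0) =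
        S \ Finset.univ.image g := by
      ext i
      simp only [Finset.mem_erase, Finset.mem_sdiff, Finset.mem_image, Finset.mem_univ, true_and,
        Fin.exists_fin_succ, not_or]
      tauto
    -- The outermost derivative moves to the test function, whose support does not grow; its sign
    -- cancels the one in `splineIntegral_fderiv`.
    have h1 := ih (fun j => g j.succ) (fun a b h => Fin.succ_injective _ (hg h))
      (fun j => hgS _) (∂_{X (g 0)} φ) ((tsupport_lineDerivOp_subset φ _).trans hφ)
    rw [LineDeriv.iteratedLineDerivOp_succ_left, Distribution.lineDerivOp_apply_apply, map_neg]
    refine (congrArg Neg.neg h1).trans ?_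
    rw [coe_lineDerivOp, splineIntegral_fderiv hX hC hmem (contDiff_one φ) φ.hasCompactSupport,
      neg_neg, herase]

/-- Integration by parts against a compactly supported function moves each derivative onto the
density. Analyticity is what is tracked because it survives differentiation and suffices for the
identity theorem. -/
theorem exists_iteratedLineDerivOp_density [FiniteDimensional ℝ V] [MeasurableSpace V]
    [BorelSpace V] (dx : Measure V) [dx.IsAddHaarMeasure] {f : Distr V} {q : V → ℝ}
    (hq : AnalyticOnNhd ℝ q Set.univ)
    (hf : ∀ φ : 𝓓((⊤ : Opens V), ℝ), f φ = ∫ x, q x * φ x ∂dx) {k : ℕ} (v : Fin k → V) :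
    ∃ r : V → ℝ, AnalyticOnNhd ℝ r Set.univ ∧
      ∀ φ : 𝓓((⊤ : Opens V), ℝ), (∂^{v} f) φ = ∫ x, r x * φ x ∂dx := by
  induction k with
  | zero => exact ⟨q, hq, by simpa using hf⟩
  | succ k ih =>
    obtain ⟨r, hr, hr'⟩ := ih (Fin.tail v)
    have hr'' : AnalyticOnNhd ℝ (fun x => fderiv ℝ r x (v 0)) Set.univ :=
      fun x hx => ((ContinuousLinearMap.apply ℝ ℝ (v 0)).analyticAt _).comp (hr.fderiv x hx)
    refine ⟨_, hr'', fun φ => ?_⟩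
    have hcr : Continuous r := continuousOn_univ.1 hr.continuousOn
    have hcr' := continuousOn_univ.1 hr''.continuousOn
    have hφ := contDiff_one φ
    rw [LineDeriv.iteratedLineDerivOp_succ_left, Distribution.lineDerivOp_apply_apply, map_neg,
      hr', coe_lineDerivOp, integral_mul_fderiv_eq_neg_fderiv_mul_of_integrable, neg_neg]
    · exact (hcr'.mul φ.continuous).integrable_of_hasCompactSupport φ.hasCompactSupport.mul_left
    · exact (hcr.mul ((hφ.continuous_fderiv one_ne_zero).clm_apply
        continuous_const)).integrable_of_hasCompactSupport
        (φ.hasCompactSupport.fderiv_apply ℝ (v 0)).mul_left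
    · exact (hcr.mul φ.continuous).integrable_of_hasCompactSupport φ.hasCompactSupport.mul_left
    · exact fun x _ => (hr x trivial).differentiableAt
    · exact fun x _ => hφ.differentiable one_ne_zero x

/-- An analytic density vanishing on a nonempty open set is zero. -/
theorem eq_zero_of_density_of_forall_eq_zero [FiniteDimensional ℝ V] [MeasurableSpace V]
    [BorelSpace V] (dx : Measure V) [dx.IsAddHaarMeasure] {f : Distr V} {q : V → ℝ}
    (hq : AnalyticOnNhd ℝ q Set.univ)
    (hf : ∀ φ : 𝓓((⊤ : Opens V), ℝ), f φ = ∫ x, q x * φ x ∂dx) {c : Set V} (hc : IsOpen c)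
    (hne : c.Nonempty) (h0 : ∀ φ : 𝓓((⊤ : Opens V), ℝ), tsupport φ ⊆ c → f φ = 0) : f = 0 := by
  have hcq : Continuous q := continuousOn_univ.1 hq.continuousOn
  have hae := hc.ae_eq_zero_of_integral_contDiff_smul_eq_zero (f := q) (μ := dx)
    (hcq.locallyIntegrable.locallyIntegrableOn _) fun g hg hgc hgs => by
      have := h0 ⟨g, hg, hgc, fun _ _ => trivial⟩ hgs
      rw [hf] at this
      simp only [smul_eq_mul, mul_comm (g _)]
      exact this
  have heq : Set.EqOn q 0 c := Measure.eqOn_open_of_ae_eq (μ := dx)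
    ((ae_restrict_iff' hc.measurableSet).2 hae) hc hcq.continuousOn continuousOn_const
  obtain ⟨x, hx⟩ := hne
  have hq0 : q = 0 := hq.eq_of_eventuallyEq (z₀ := x) analyticOnNhd_const
    (Filter.eventually_of_mem (hc.mem_nhds hx) heq)
  ext φ
  simp [hf, hq0]

end Derivatives

end BigCell

theorem theorem4p8 {V : Type*} [NormedAddCommGroup V] [NormedSpace ℝ V] [FiniteDimensional ℝ V]
    [MeasurableSpace V] [BorelSpace V] (dx : MeasureTheory.Measure V) [dx.IsAddHaarMeasure]
    (m : ℕ) (X : Fin m → V) (hX : ∀ i, X i ≠ 0)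
    (hspan : BigCell.Spans X Finset.univ)
    (hC : BigCell.GeneratesPointedCone X)
    (c : Set V) (hc : BigCell.IsBigCell X c) :
    ∃ f ∈ BigCell.dahmenMicchelli X, BigCell.IsPolynomialDensity dx f ∧
      BigCell.AgreeOn (BigCell.multivariateSpline X hX hC) f c := by
  obtain ⟨x, hx, rfl⟩ := hc
  set c := connectedComponentIn (BigCell.singularVectors X)ᶜ x
  have hcs : c ⊆ (BigCell.singularVectors X)ᶜ := connectedComponentIn_subset _ _
  have hopen : IsOpen c := (BigCell.isClosed_singularVectors hX hC).isOpen_compl.connectedComponentIn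
  have hne : c.Nonempty := ⟨x, mem_connectedComponentIn hx⟩
  obtain ⟨P, hP⟩ := BigCell.exists_splineIntegral_eq_integral_eval dx hX hC
    isPreconnected_connectedComponentIn hcs Finset.univ
  have han := BigCell.analyticOnNhd_eval (V := V) P
  set q : V → ℝ := fun x => MvPolynomial.eval (fun l => l x) P
  have hloc : LocallyIntegrableOn q ((⊤ : Opens V) : Set V) dx :=
    ((continuousOn_univ.1 han.continuousOn).locallyIntegrable).locallyIntegrableOn _
  obtain ⟨f, hf⟩ : ∃ f : BigCell.Distr V, ∀ φ, f φ = ∫ x, q x * φ x ∂dx := by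
    refine ⟨TestFunction.integralAgainstBilinCLM (ContinuousLinearMap.mul ℝ ℝ) dx q, fun φ => ?_⟩
    refine (TestFunction.integralAgainstBilinCLM_eq_integral hloc).trans ?_
    simp [mul_comm]
  have hfs : ∀ φ : 𝓓((⊤ : Opens V), ℝ), tsupport φ ⊆ c →
      f φ = BigCell.splineIntegral X Finset.univ φ := fun φ hφ => by
    rw [hf, hP φ (BigCell.contDiff_one φ) φ.hasCompactSupport hφ]
  refine ⟨f, fun I hI => ?_, ⟨q, ⟨P, fun _ => rfl⟩, hf⟩, fun φ hφ => ?_⟩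
  · obtain ⟨r, hr, hr'⟩ := BigCell.exists_iteratedLineDerivOp_density dx han hf
      fun i : Fin I.card => X (I.orderEmbOfFin rfl i)
    -- It is enough to test `∂_Y f` on the cell, where `f` is the spline of `X` and `∂_Y f` that of
    -- the nonspanning complement of `Y`.
    refine BigCell.eq_zero_of_density_of_forall_eq_zero dx hr hr' hopen hne fun φ hφ => ?_
    refine (BigCell.iteratedLineDerivOp_eq_splineIntegral hX hC hfs _
      (I.orderEmbOfFin rfl).injective (fun _ => Finset.mem_univ _) φ hφ).trans ?_
    refine BigCell.splineIntegral_eq_zero ?_ (hφ.trans hcs)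
    rw [Finset.image_orderEmbOfFin_univ, ← Finset.compl_eq_univ_sdiff]
    exact hI.prop
  · rw [hfs φ hφ]
    unfold BigCell.splineIntegral
    rw [BigCell.orthantMeasure_univ]
    simp only [BigCell.sumSMul_apply]
    rfl
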